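/- Let $X$ and $Y$ be Banach spaces over $\mathbb{R}$ or $\mathbb{C}$, with $X$ separable and reflexive, and let $\mathcal L$ be a set of bounded linear operators $L : X \to Y$, equipped with a topology $\tau$ such that $(\mathcal L,\tau)$ is Hausdorff, $\sigma$-compact and locally compact, and such that for every $x\in X$ the map $L\mapsto Lx$ is continuous from $(\mathcal L,\tau)$ to $Y$. Write $L\to\infty$ for $L$ escaping all compact subsets of $(\mathcal L,\tau)$. Put $$M = M(X,\mathcal L)=\Big\{x\in X : \sup_{L\in\mathcal L}\|Lx\|_Y<\infty\Big\},\qquad \|x\|_M=\sup_{L\in\mathcal L}\|Lx\|_Y,$$ $$M_0 = M_0(X,\mathcal L)=\Big\{x\in M : \limsup_{\mathcal L\ni L\to\infty}\|Lx\|_Y=0\Big\}$$ (if $(\mathcal L,\tau)$ is compact, the $\limsup$ is read as $0$, so that $M_0=M$). Assume that $M$ is dense in $X$ with respect to the norm of $X$, that $(M,\|\cdot\|_M)$ is a Banach space continuously contained in $X$, and that for every $x\in M$ there is a sequence $(x_n)_{n\ge 1}$ in $M_0$ which converges to $x$ weakly in $X$ and satisfies $\sup_n\|x_n\|_M\le\|x\|_M$.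 Then for every $x\in M$ the distance from $x$ to $M_0$ in the norm of $M$ is attained, and $$\operatorname{dist}(x,M_0)_M=\min_{x_0\in M_0}\|x-x_0\|_M=\limsup_{\mathcal L\ni L\to\infty}\|Lx\|_Y .$$ -/

import Mathlib

open Filter Topology

/-- The index space of a family `𝓛` of bounded operators. Its points are the elements of `𝓛`, but
it is a separate type, so that it carries no topology except the one (called `τ`) which is
chosen explicitly; in particular it does not inherit the operator-norm topology. -/
def OpFamily {𝕜 X Y : Type*} [RCLike 𝕜] [NormedAddCommGroup X] [NormedSpace 𝕜 X]
    [NormedAddCommGroup Y] [NormedSpace 𝕜 Y] (𝓛 : Set (X →L[𝕜] Y)) : Type _ :=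
  {L : X →L[𝕜] Y // L ∈ 𝓛}

section Pair

variable {𝕜 X Y : Type*} [RCLike 𝕜] [NormedAddCommGroup X] [NormedSpace 𝕜 X]
  [NormedAddCommGroup Y] [NormedSpace 𝕜 Y]

/-- A point of the index space, as a bounded operator. -/
def OpFamily.op {𝓛 : Set (X →L[𝕜] Y)} (L : OpFamily 𝓛) : X →L[𝕜] Y := L.1

/-- The vectors `x` with `sup_{L ∈ 𝓛} ‖L x‖ < ∞`, as a linear subspace of `X`. -/
def bigOSubmodule (𝓛 : Set (X →L[𝕜] Y)) : Submodule 𝕜 X where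
  carrier := {x | BddAbove (Set.range fun L : OpFamily 𝓛 => ‖L.op x‖)}
  zero_mem' := ⟨0, by rintro _ ⟨L, rfl⟩; simp⟩
  add_mem' := by
    rintro x y ⟨a, ha⟩ ⟨b, hb⟩
    refine ⟨a + b, ?_⟩
    rintro _ ⟨L, rfl⟩
    have h1 := ha ⟨L, rfl⟩
    have h2 := hb ⟨L, rfl⟩
    simp only [map_add]
    exact (norm_add_le _ _).trans (add_le_add h1 h2)
  smul_mem' := by
    rintro c x ⟨a, ha⟩
    refine ⟨‖c‖ * a, ?_⟩
    rintro _ ⟨L, rfl⟩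
    have h1 := ha ⟨L, rfl⟩
    simp only [map_smul, norm_smul]
    exact mul_le_mul_of_nonneg_left h1 (norm_nonneg c)

/-- The big-`O` space `M(X, 𝓛)`. It is a separate type, so that it carries the norm
`‖x‖_M = sup_{L ∈ 𝓛} ‖L x‖` defined below and not the norm of `X`. -/
def BigO (𝓛 : Set (X →L[𝕜] Y)) : Type _ := bigOSubmodule 𝓛

namespace BigO

variable {𝓛 : Set (X →L[𝕜] Y)}

instance : AddCommGroup (BigO 𝓛) := inferInstanceAs (AddCommGroup (bigOSubmodule 𝓛))

instance : Module 𝕜 (BigO 𝓛) := inferInstanceAs (Module 𝕜 (bigOSubmodule 𝓛))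

/-- The inclusion of `M(X, 𝓛)` in `X`. -/
def incl (𝓛 : Set (X →L[𝕜] Y)) : BigO 𝓛 →ₗ[𝕜] X := (bigOSubmodule 𝓛).subtype

theorem bddAbove (x : BigO 𝓛) : BddAbove (Set.range fun L : OpFamily 𝓛 => ‖L.op (incl 𝓛 x)‖) :=
  x.2

/-- The norm `‖x‖_M = sup_{L ∈ 𝓛} ‖L x‖`. -/
noncomputable instance : Norm (BigO 𝓛) := ⟨fun x => ⨆ L : OpFamily 𝓛, ‖L.op (incl 𝓛 x)‖⟩

theorem norm_def (x : BigO 𝓛) : ‖x‖ = ⨆ L : OpFamily 𝓛, ‖L.op (incl 𝓛 x)‖ := rfl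

theorem norm_op_le (x : BigO 𝓛) (L : OpFamily 𝓛) : ‖L.op (incl 𝓛 x)‖ ≤ ‖x‖ :=
  le_ciSup x.bddAbove L

theorem norm_nonneg' (x : BigO 𝓛) : 0 ≤ ‖x‖ := Real.iSup_nonneg fun _ => norm_nonneg _

theorem norm_le_of {x : BigO 𝓛} {a : ℝ} (ha : 0 ≤ a)
    (h : ∀ L : OpFamily 𝓛, ‖L.op (incl 𝓛 x)‖ ≤ a) : ‖x‖ ≤ a :=
  Real.iSup_le h ha

/-- In general `‖·‖_M` is only a seminorm; it is a norm as soon as `M(X, 𝓛)` is continuously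
contained in `X`. -/
noncomputable instance : SeminormedAddCommGroup (BigO 𝓛) :=
  AddGroupSeminorm.toSeminormedAddCommGroup
    { toFun := fun x => ‖x‖
      map_zero' := by simp [norm_def]
      add_le' := fun x y => norm_le_of (add_nonneg x.norm_nonneg' y.norm_nonneg') fun L => by
        simp only [map_add]
        exact (norm_add_le _ _).trans (add_le_add (x.norm_op_le L) (y.norm_op_le L))
      neg' := fun x => by simp [norm_def] }

noncomputable instance : NormedSpace 𝕜 (BigO 𝓛) where
  norm_smul_le c x := norm_le_of (mul_nonneg (norm_nonneg c) x.norm_nonneg') fun L => by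
    simp only [map_smul, norm_smul]
    exact mul_le_mul_of_nonneg_left (x.norm_op_le L) (norm_nonneg c)

end BigO

/-- `limsup_{L → ∞} ‖L x‖` for `x` in `M(X, 𝓛)`; here `L → ∞` means that `L` leaves every compact
subset of `(𝓛, τ)`. (If `(𝓛, τ)` is compact, the value is `0`.) -/
noncomputable def limsupAtInfty (𝓛 : Set (X →L[𝕜] Y)) [TopologicalSpace (OpFamily 𝓛)]
    (x : BigO 𝓛) : ℝ :=
  limsup (fun L : OpFamily 𝓛 => ‖L.op (BigO.incl 𝓛 x)‖) (cocompact (OpFamily 𝓛))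

theorem limsupAtInfty_eq_zero_iff {𝓛 : Set (X →L[𝕜] Y)} [TopologicalSpace (OpFamily 𝓛)]
    (x : BigO 𝓛) : limsupAtInfty 𝓛 x = 0 ↔
      Tendsto (fun L : OpFamily 𝓛 => L.op (BigO.incl 𝓛 x)) (cocompact (OpFamily 𝓛)) (𝓝 0) := by
  rw [tendsto_zero_iff_norm_tendsto_zero]
  rcases (cocompact (OpFamily 𝓛)).eq_or_neBot with hb | hb
  · simp [limsupAtInfty, hb, limsup, limsSup]
  constructor
  · intro h
    refine tendsto_order.2 ⟨fun a ha => .of_forall fun L => ha.trans_le (norm_nonneg _),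
      fun a ha => ?_⟩
    exact eventually_lt_of_limsup_lt (h.trans_lt ha)
      (isBoundedUnder_of ⟨‖x‖, fun L => x.norm_op_le L⟩)
  · exact fun h => h.limsup_eq

/-- The little-`o` space `M₀(X, 𝓛)`: those `x` in `M(X, 𝓛)` with `limsup_{L → ∞} ‖L x‖ = 0`. -/
def LittleO (𝓛 : Set (X →L[𝕜] Y)) [TopologicalSpace (OpFamily 𝓛)] : Submodule 𝕜 (BigO 𝓛) where
  carrier := {x | limsupAtInfty 𝓛 x = 0}
  zero_mem' := by
    simp only [Set.mem_ofPred_eq, limsupAtInfty_eq_zero_iff, map_zero]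
    exact tendsto_const_nhds
  add_mem' := by
    intro x y hx hy
    simp only [Set.mem_ofPred_eq, limsupAtInfty_eq_zero_iff, map_add] at hx hy ⊢
    simpa using hx.add hy
  smul_mem' := by
    intro c x hx
    simp only [Set.mem_ofPred_eq, limsupAtInfty_eq_zero_iff, map_smul] at hx ⊢
    simpa using hx.const_smul c

end Pair

/-! Elements of `M₀` are invisible at infinity, so the `limsup` `d` is a lower bound for the
distance. To attain it, the excess of `‖y‖_M` over `d` lives on a compact `K`, where it must be cut
without enlarging `L y` elsewhere. Mazur and uniform boundedness give approximants of `y` in `M₀`,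
uniformly close on compact sets and no larger than `y`. Their average, each one good wherever the
earlier ones are not negligible, is a cut-off (`exists_littleO_cutoff`): each `L` sees negligible
terms, then at most one uncontrolled term, then good ones. Subtracting a fraction of the cut-off
removes an excess `ε` at cost `ε` (`exists_littleO_correction`). Halving the excess at each step
makes the corrections summable, and the limit stays in the closed subspace `M₀`. -/

namespace BigO

variable {𝕜 X Y : Type*} [RCLike 𝕜] [NormedAddCommGroup X] [NormedSpace 𝕜 X]
  [NormedAddCommGroup Y] [NormedSpace 𝕜 Y] {𝓛 : Set (X →L[𝕜] Y)}

/-! ### Approximation by `M₀`, uniformly on compact sets -/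

theorem isBoundedUnder_norm_op (x : BigO 𝓛) (l : Filter (OpFamily 𝓛)) :
    l.IsBoundedUnder (· ≤ ·) fun L : OpFamily 𝓛 => ‖L.op (incl 𝓛 x)‖ :=
  isBoundedUnder_of ⟨‖x‖, fun L => x.norm_op_le L⟩

/-- If `y` is the weak limit of a sequence in `M₀` bounded by `‖y‖_M`, then it is also the norm
limit in `X` of such elements (Mazur). -/
theorem exists_littleO_norm_incl_sub_lt [TopologicalSpace (OpFamily 𝓛)] {y : BigO 𝓛}
    {u : ℕ → BigO 𝓛} (hu : ∀ n, u n ∈ LittleO 𝓛)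
    (hlim : ∀ φ : StrongDual 𝕜 X,
      Tendsto (fun n => φ (incl 𝓛 (u n))) atTop (𝓝 (φ (incl 𝓛 y))))
    (hle : ∀ n, ‖u n‖ ≤ ‖y‖) {η : ℝ} (hη : 0 < η) :
    ∃ v ∈ LittleO 𝓛, ‖v‖ ≤ ‖y‖ ∧ ‖incl 𝓛 (y - v)‖ < η := by
  let _ : NormedSpace ℝ X := NormedSpace.restrictScalars ℝ 𝕜 X
  have _ : IsScalarTower ℝ 𝕜 X := RestrictScalars.isScalarTower ℝ 𝕜 X
  set S : Set X := incl 𝓛 '' {v | v ∈ LittleO 𝓛 ∧ ‖v‖ ≤ ‖y‖} with hS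
  have hconv : Convex ℝ S := by
    rintro _ ⟨v, ⟨hv, hvn⟩, rfl⟩ _ ⟨w, ⟨hw, hwn⟩, rfl⟩ a b ha hb hab
    refine ⟨(a : 𝕜) • v + (b : 𝕜) • w,
      ⟨(LittleO 𝓛).add_mem ((LittleO 𝓛).smul_mem _ hv) ((LittleO 𝓛).smul_mem _ hw), ?_⟩, ?_⟩
    · calc ‖(a : 𝕜) • v + (b : 𝕜) • w‖ ≤ a * ‖v‖ + b * ‖w‖ := by
            refine (norm_add_le _ _).trans_eq ?_
            rw [norm_smul, norm_smul, RCLike.norm_of_nonneg ha, RCLike.norm_of_nonneg hb]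
        _ ≤ a * ‖y‖ + b * ‖y‖ := by gcongr
        _ = ‖y‖ := by rw [← add_mul, hab, one_mul]
    · simp only [map_add, map_smul]
      rw [RCLike.real_smul_eq_coe_smul (K := 𝕜) a, RCLike.real_smul_eq_coe_smul (K := 𝕜) b]
  have hmem : incl 𝓛 y ∈ closure S := by
    by_contra hy
    obtain ⟨f, c, hfy, hfc⟩ :=
      RCLike.geometric_hahn_banach_point_closed (𝕜 := 𝕜) hconv.closure isClosed_closure hy
    have h1 := (RCLike.continuous_re.tendsto _).comp (hlim f)
    have h2 : c ≤ RCLike.re (f (incl 𝓛 y)) := ge_of_tendsto' h1 fun n =>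
      (hfc _ (subset_closure ⟨u n, ⟨hu n, hle n⟩, rfl⟩)).le
    exact absurd hfy h2.not_gt
  obtain ⟨_, ⟨v, ⟨hv, hvn⟩, rfl⟩, hd⟩ := Metric.mem_closure_iff.1 hmem η hη
  exact ⟨v, hv, hvn, by rwa [map_sub, ← dist_eq_norm]⟩

variable [TopologicalSpace (OpFamily 𝓛)]

/-- A pointwise continuous family of operators on a Banach space is bounded on compact sets. -/
theorem exists_norm_op_le_of_isCompact [CompleteSpace X]
    (hcont : ∀ x : X, Continuous fun L : OpFamily 𝓛 => L.op x)
    {K : Set (OpFamily 𝓛)} (hK : IsCompact K) : ∃ C > 0, ∀ L ∈ K, ‖L.op‖ ≤ C := by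
  obtain ⟨C, hC⟩ := banach_steinhaus (g := fun L : K => L.1.op) fun x => by
    obtain ⟨B, hB⟩ := hK.exists_bound_of_continuousOn (hcont x).continuousOn
    exact ⟨B, fun L => hB L.1 L.2⟩
  -- The maximum makes the bound positive, so that tolerances can be divided by it.
  exact ⟨max C 1, by positivity, fun L hL => (hC ⟨L, hL⟩).trans (le_max_left _ _)⟩

/-! ### The `limsup` at infinity modulo `M₀` -/

theorem eventually_norm_op_le_of_mem_littleO {w : BigO 𝓛} (hw : w ∈ LittleO 𝓛) {η : ℝ}
    (hη : 0 < η) : ∀ᶠ L : OpFamily 𝓛 in cocompact (OpFamily 𝓛), ‖L.op (incl 𝓛 w)‖ ≤ η := by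
  have h := ((limsupAtInfty_eq_zero_iff w).1 hw).norm
  rw [norm_zero] at h
  exact (h.eventually_lt_const hη).mono fun L hL => hL.le

theorem isClosed_littleO : IsClosed (LittleO 𝓛 : Set (BigO 𝓛)) := by
  refine isClosed_of_closure_subset fun x hx => (limsupAtInfty_eq_zero_iff x).2 ?_
  refine Metric.tendsto_nhds.2 fun ε hε => ?_
  obtain ⟨w, hw, hxw⟩ := Metric.mem_closure_iff.1 hx (ε / 2) (half_pos hε)
  filter_upwards [eventually_norm_op_le_of_mem_littleO hw (half_pos hε)] with L hL
  have h1 := (x - w).norm_op_le L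
  rw [dist_eq_norm] at hxw
  rw [dist_zero_right]
  calc ‖L.op (incl 𝓛 x)‖ = ‖L.op (incl 𝓛 (x - w)) + L.op (incl 𝓛 w)‖ := by simp
    _ ≤ ‖L.op (incl 𝓛 (x - w))‖ + ‖L.op (incl 𝓛 w)‖ := norm_add_le _ _
    _ < ε := by linarith

theorem limsupAtInfty_nonneg (x : BigO 𝓛) : 0 ≤ limsupAtInfty 𝓛 x := by
  -- If the family is compact, the filter is `⊥` and the `limsup` is the infimum of all of `ℝ`,
  -- which is `0` by convention.
  rcases (cocompact (OpFamily 𝓛)).eq_or_neBot with hb | hb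
  · simp [limsupAtInfty, hb, limsup, limsSup]
  · exact le_limsup_of_frequently_le (Frequently.of_forall fun L => norm_nonneg _)
      (isBoundedUnder_norm_op x _)

theorem limsupAtInfty_le {x : BigO 𝓛} {c : ℝ} (hc : 0 ≤ c)
    (h : ∀ᶠ L : OpFamily 𝓛 in cocompact (OpFamily 𝓛), ‖L.op (incl 𝓛 x)‖ ≤ c) :
    limsupAtInfty 𝓛 x ≤ c := by
  rcases (cocompact (OpFamily 𝓛)).eq_or_neBot with hb | hb
  · simpa [limsupAtInfty, hb, limsup, limsSup] using hc
  · exact limsup_le_of_le (isCoboundedUnder_le_of_le _ fun L => norm_nonneg _) h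

theorem eventually_norm_op_le_limsupAtInfty_add (x : BigO 𝓛) {δ : ℝ} (hδ : 0 < δ) :
    ∀ᶠ L : OpFamily 𝓛 in cocompact (OpFamily 𝓛),
      ‖L.op (incl 𝓛 x)‖ ≤ limsupAtInfty 𝓛 x + δ :=
  (eventually_lt_of_limsup_lt (lt_add_of_pos_right _ hδ)
    (isBoundedUnder_norm_op x _)).mono fun _ hL => hL.le

/-- `limsup_{L → ∞} ‖L x‖` depends only on the class of `x` modulo `M₀`. -/
theorem limsupAtInfty_sub_le (x : BigO 𝓛) {w : BigO 𝓛} (hw : w ∈ LittleO 𝓛) :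
    limsupAtInfty 𝓛 (x - w) ≤ limsupAtInfty 𝓛 x := by
  refine le_of_forall_pos_le_add fun δ hδ => ?_
  refine limsupAtInfty_le (add_nonneg (limsupAtInfty_nonneg x) hδ.le) ?_
  filter_upwards [eventually_norm_op_le_limsupAtInfty_add x (half_pos hδ),
    eventually_norm_op_le_of_mem_littleO hw (half_pos hδ)] with L h1 h2
  rw [map_sub, map_sub]
  linarith [norm_sub_le (L.op (incl 𝓛 x)) (L.op (incl 𝓛 w))]

theorem limsupAtInfty_le_norm_sub (x : BigO 𝓛) {w : BigO 𝓛} (hw : w ∈ LittleO 𝓛) :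
    limsupAtInfty 𝓛 x ≤ ‖x - w‖ := by
  have h : limsupAtInfty 𝓛 ((x - w) - (-w)) ≤ limsupAtInfty 𝓛 (x - w) :=
    limsupAtInfty_sub_le _ ((LittleO 𝓛).neg_mem hw)
  rw [sub_neg_eq_add, sub_add_cancel] at h
  exact h.trans (limsupAtInfty_le (norm_nonneg _) (.of_forall fun L => (x - w).norm_op_le L))

/-! ### Averaged cut-offs and corrections -/

/-- `N` times the average of `N` approximants of `y`, chosen so that they are negligible at
infinity one after the other. -/
theorem exists_littleO_sum {y : BigO 𝓛}
    (happ : ∀ K : Set (OpFamily 𝓛), IsCompact K → ∀ η > 0, ∃ v ∈ LittleO 𝓛, ‖v‖ ≤ ‖y‖ ∧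
      ∀ L ∈ K, ‖L.op (incl 𝓛 (y - v))‖ ≤ η) {η : ℝ} (hη : 0 < η) (N : ℕ) :
    ∀ K : Set (OpFamily 𝓛), IsCompact K → ∃ s ∈ LittleO 𝓛, ‖s‖ ≤ N * ‖y‖ ∧
      ∀ L : OpFamily 𝓛,
        (∃ c : ℝ, 0 ≤ c ∧ c ≤ N ∧
          ‖L.op (incl 𝓛 ((N : 𝕜) • y - s - (c : 𝕜) • y))‖ ≤ N * η + 2 * ‖y‖) ∧
        (L ∈ K → ‖L.op (incl 𝓛 ((N : 𝕜) • y - s))‖ ≤ N * η) := by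
  induction N with
  | zero =>
    refine fun K _ => ⟨0, (LittleO 𝓛).zero_mem, by simp, fun L => ⟨⟨0, le_rfl, by simp, ?_⟩, ?_⟩⟩
    · simp
    · simp
  | succ N ih =>
    intro K hK
    obtain ⟨v, hv, hvn, hvK⟩ := happ K hK η hη
    obtain ⟨T, hT, hvT⟩ := (hasBasis_cocompact.eventually_iff).1
      (eventually_norm_op_le_of_mem_littleO hv hη)
    -- The remaining `N` approximants must be good on `T` too, since `v` is negligible only off `T`.
    obtain ⟨s, hs, hsn, hsL⟩ := ih (K ∪ T) (hK.union hT)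
    refine ⟨v + s, (LittleO 𝓛).add_mem hv hs, ?_, fun L => ?_⟩
    · push_cast
      linarith [norm_add_le v s]
    have hyv : ‖L.op (incl 𝓛 (y - v))‖ ≤ 2 * ‖y‖ :=
      ((y - v).norm_op_le L).trans (by linarith [norm_sub_le y v])
    have hin : L ∈ K ∪ T → ‖L.op (incl 𝓛 (((N + 1 : ℕ) : 𝕜) • y - (v + s)))‖ ≤
        ‖L.op (incl 𝓛 (y - v))‖ + N * η := fun hL => by
      have e : ((N + 1 : ℕ) : 𝕜) • y - (v + s) = (y - v) + ((N : 𝕜) • y - s) := by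
        push_cast
        module
      rw [e, map_add, map_add]
      exact (norm_add_le _ _).trans (add_le_add le_rfl ((hsL L).2 hL))
    refine ⟨?_, fun hL => ?_⟩
    · by_cases hL : L ∈ K ∪ T
      · refine ⟨0, le_rfl, by positivity, ?_⟩
        rw [RCLike.ofReal_zero, zero_smul, sub_zero]
        push_cast at hin ⊢
        linarith [hin hL]
      · obtain ⟨c, hc0, hcN, hc⟩ := (hsL L).1
        -- Here `L v` is negligible, so `y - v` counts as one more copy of `y`; the term `2 * ‖y‖`
        -- is inherited, not paid again.
        refine ⟨c + 1, by positivity, by push_cast; linarith, ?_⟩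
        have e : ((N + 1 : ℕ) : 𝕜) • y - (v + s) - ((c + 1 : ℝ) : 𝕜) • y =
            ((N : 𝕜) • y - s - (c : 𝕜) • y) - v := by
          push_cast
          module
        have hLv : ‖L.op (incl 𝓛 v)‖ ≤ η := hvT fun h => hL (Or.inr h)
        rw [e, map_sub, map_sub]
        push_cast
        linarith [norm_sub_le (L.op (incl 𝓛 ((N : 𝕜) • y - s - (c : 𝕜) • y))) (L.op (incl 𝓛 v))]
    · have := hin (Or.inl hL)
      have := hvK L hL
      push_cast at *
      linarith

/-- Cut-off: some `w` in `M₀` is close to `y` on `K`, and everywhere `L (y - w)` is close to a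
multiple of `L y` by a factor in `[0, 1]`. -/
theorem exists_littleO_cutoff {y : BigO 𝓛}
    (happ : ∀ K : Set (OpFamily 𝓛), IsCompact K → ∀ η > 0, ∃ v ∈ LittleO 𝓛, ‖v‖ ≤ ‖y‖ ∧
      ∀ L ∈ K, ‖L.op (incl 𝓛 (y - v))‖ ≤ η) {δ : ℝ} (hδ : 0 < δ)
    {K : Set (OpFamily 𝓛)} (hK : IsCompact K) :
    ∃ w ∈ LittleO 𝓛, ‖w‖ ≤ ‖y‖ ∧ ∀ L : OpFamily 𝓛,
      (∃ c : ℝ, 0 ≤ c ∧ c ≤ 1 ∧ ‖L.op (incl 𝓛 (y - w - (c : 𝕜) • y))‖ ≤ δ) ∧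
      (L ∈ K → ‖L.op (incl 𝓛 (y - w))‖ ≤ δ) := by
  -- After division by `n`, the one uncontrolled term costs less than `δ / 2`; the tolerance `η = δ
  -- / 2` supplies the other half.
  obtain ⟨n, hn⟩ := exists_nat_gt (2 * ‖y‖ / (δ / 2))
  have hn0 : (0 : ℝ) < n := lt_of_le_of_lt (by positivity) hn
  have hn' : 2 * ‖y‖ < n * (δ / 2) := (div_lt_iff₀ (half_pos hδ)).1 hn
  obtain ⟨s, hs, hsn, hsL⟩ := exists_littleO_sum happ (half_pos hδ) n K hK
  have hk : (n : 𝕜) ≠ 0 := by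
    have : n ≠ 0 := by rintro rfl; simp at hn0
    exact_mod_cast this
  have hnorm : ‖(n : 𝕜)⁻¹‖ = (n : ℝ)⁻¹ := by rw [norm_inv, RCLike.norm_natCast]
  have scale : ∀ (L : OpFamily 𝓛) (z : BigO 𝓛) (b : ℝ), ‖L.op (incl 𝓛 z)‖ ≤ n * b →
      ‖L.op (incl 𝓛 ((n : 𝕜)⁻¹ • z))‖ ≤ b := fun L z b h => by
    rw [map_smul, map_smul, norm_smul, hnorm]
    exact (inv_mul_le_iff₀ hn0).2 h
  refine ⟨(n : 𝕜)⁻¹ • s, (LittleO 𝓛).smul_mem _ hs, ?_, fun L => ⟨?_, fun hL => ?_⟩⟩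
  · rw [norm_smul, hnorm]
    exact (inv_mul_le_iff₀ hn0).2 hsn
  · obtain ⟨c, hc0, hcn, hc⟩ := (hsL L).1
    refine ⟨c / n, by positivity, (div_le_one hn0).2 hcn, ?_⟩
    have e : y - (n : 𝕜)⁻¹ • s - ((c / n : ℝ) : 𝕜) • y =
        (n : 𝕜)⁻¹ • ((n : 𝕜) • y - s - (c : 𝕜) • y) := by
      rw [smul_sub, smul_sub, inv_smul_smul₀ hk, smul_smul]
      push_cast
      rw [div_eq_inv_mul]
    rw [e]
    exact scale L _ _ (by linarith)
  · have e : y - (n : 𝕜)⁻¹ • s = (n : 𝕜)⁻¹ • ((n : 𝕜) • y - s) := by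
      rw [smul_sub, inv_smul_smul₀ hk]
    rw [e]
    exact scale L _ _ (((hsL L).2 hL).trans (by nlinarith))

/-- If `‖y‖_M` exceeds `d ≥ limsup_{L → ∞} ‖L y‖` by at most `ε`, then a correction in `M₀` of norm
at most `ε` brings it as close to `d` as desired. -/
theorem exists_littleO_correction {y : BigO 𝓛}
    (happ : ∀ K : Set (OpFamily 𝓛), IsCompact K → ∀ η > 0, ∃ v ∈ LittleO 𝓛, ‖v‖ ≤ ‖y‖ ∧
      ∀ L ∈ K, ‖L.op (incl 𝓛 (y - v))‖ ≤ η) {d ε δ : ℝ} (hd : limsupAtInfty 𝓛 y ≤ d)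
    (hε : 0 < ε) (hδ : 0 < δ) (hy : ‖y‖ ≤ d + ε) :
    ∃ z ∈ LittleO 𝓛, ‖z‖ ≤ ε ∧ ‖y - z‖ ≤ d + δ := by
  have hd0 : 0 ≤ d := (limsupAtInfty_nonneg y).trans hd
  obtain ⟨K, hK, hKy⟩ := (hasBasis_cocompact.eventually_iff).1
    (eventually_norm_op_le_limsupAtInfty_add y (half_pos hδ))
  obtain ⟨w, hw, hwn, hwL⟩ := exists_littleO_cutoff happ (half_pos hδ) hK
  -- This `t` gives both `t * (d + ε) = ε`, the size of the correction, and `(1 - t) * (d + ε) = d`,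
  -- the bound reached on `K`.
  set t : ℝ := ε / (d + ε) with ht
  have hdε : 0 < d + ε := by positivity
  have ht0 : 0 ≤ t := by positivity
  have ht1 : t ≤ 1 := (div_le_one hdε).2 (by linarith)
  have htε : t * (d + ε) = ε := div_mul_cancel₀ _ hdε.ne'
  have hnt : ∀ r : ℝ, 0 ≤ r → ∀ z : BigO 𝓛, ∀ L : OpFamily 𝓛,
      ‖L.op (incl 𝓛 ((r : 𝕜) • z))‖ = r * ‖L.op (incl 𝓛 z)‖ := fun r hr z L => by
    rw [map_smul, map_smul, norm_smul, RCLike.norm_of_nonneg hr]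
  refine ⟨(t : 𝕜) • w, (LittleO 𝓛).smul_mem _ hw, ?_,
    norm_le_of (by positivity) fun L => ?_⟩
  · rw [norm_smul, RCLike.norm_of_nonneg ht0]
    nlinarith
  have hyL := y.norm_op_le L
  by_cases hL : L ∈ K
  · have e : y - (t : 𝕜) • w = ((1 - t : ℝ) : 𝕜) • y + (t : 𝕜) • (y - w) := by
      push_cast
      module
    have h2 := (hwL L).2 hL
    rw [e, map_add, map_add]
    refine (norm_add_le _ _).trans ?_
    rw [hnt _ (by linarith), hnt _ ht0]
    nlinarith [norm_nonneg (L.op (incl 𝓛 (y - w)))]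
  · obtain ⟨c, hc0, hc1, hc⟩ := (hwL L).1
    have hLy : ‖L.op (incl 𝓛 y)‖ ≤ limsupAtInfty 𝓛 y + δ / 2 := hKy hL
    have hr0 : 0 ≤ 1 - t * (1 - c) := by nlinarith
    have hr1 : 1 - t * (1 - c) ≤ 1 := by nlinarith
    have e : y - (t : 𝕜) • w =
        ((1 - t * (1 - c) : ℝ) : 𝕜) • y + (t : 𝕜) • (y - w - (c : 𝕜) • y) := by
      push_cast
      module
    rw [e, map_add, map_add]
    refine (norm_add_le _ _).trans ?_
    rw [hnt _ hr0, hnt _ ht0]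
    have h1 := mul_le_of_le_one_left (norm_nonneg (L.op (incl 𝓛 y))) hr1
    have h2 := mul_le_of_le_one_left (norm_nonneg (L.op (incl 𝓛 (y - w - (c : 𝕜) • y)))) ht1
    linarith

/-- Proximinality: some `x₀` in `M₀` satisfies `‖x - x₀‖_M ≤ limsup_{L → ∞} ‖L x‖`. -/
theorem exists_littleO_norm_sub_le_limsupAtInfty [CompleteSpace (BigO 𝓛)]
    (happ : ∀ y : BigO 𝓛, ∀ K : Set (OpFamily 𝓛), IsCompact K → ∀ η > 0,
      ∃ v ∈ LittleO 𝓛, ‖v‖ ≤ ‖y‖ ∧ ∀ L ∈ K, ‖L.op (incl 𝓛 (y - v))‖ ≤ η) (x : BigO 𝓛) :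
    ∃ x₀ ∈ LittleO 𝓛, ‖x - x₀‖ ≤ limsupAtInfty 𝓛 x := by
  set d := limsupAtInfty 𝓛 x with hd
  -- With `ε 0 = ‖x‖ + 1` the iteration can start at `0`; the summand `1` keeps every `ε n` positive
  -- even when `‖x‖ = 0`.
  let ε : ℕ → ℝ := fun n => (‖x‖ + 1) / 2 ^ n
  have hε : ∀ n, 0 < ε n := fun n => by positivity
  have step : ∀ n, ∀ p : {w : BigO 𝓛 // w ∈ LittleO 𝓛 ∧ ‖x - w‖ ≤ d + ε n},
      ∃ q : {w : BigO 𝓛 // w ∈ LittleO 𝓛 ∧ ‖x - w‖ ≤ d + ε (n + 1)},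
        ‖q.1 - p.1‖ ≤ ε n := by
    rintro n ⟨w, hw, hxw⟩
    -- The correction is bounded by the current excess `ε n`, whatever the next target; hence the
    -- geometric Cauchy bound.
    obtain ⟨z, hz, hzn, hxz⟩ := exists_littleO_correction (happ (x - w))
      (limsupAtInfty_sub_le x hw) (hε n) (hε (n + 1)) hxw
    exact ⟨⟨w + z, (LittleO 𝓛).add_mem hw hz, by rwa [← sub_sub]⟩, by simpa using hzn⟩
  choose next hnext using step
  let w : ∀ n, {w : BigO 𝓛 // w ∈ LittleO 𝓛 ∧ ‖x - w‖ ≤ d + ε n} := fun n =>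
    Nat.rec ⟨0, (LittleO 𝓛).zero_mem, by
      simp only [ε, sub_zero, pow_zero, div_one]
      linarith [limsupAtInfty_nonneg x]⟩ next n
  have hcauchy : CauchySeq fun n => (w n).1 := by
    refine cauchySeq_of_le_geometric (1 / 2) (‖x‖ + 1) (by norm_num) fun n => ?_
    rw [dist_comm, dist_eq_norm, one_div, inv_pow, ← div_eq_mul_inv]
    exact hnext n (w n)
  obtain ⟨x₀, hx₀⟩ := cauchySeq_tendsto_of_complete hcauchy
  refine ⟨x₀, isClosed_littleO.mem_of_tendsto hx₀ (.of_forall fun n => (w n).2.1), ?_⟩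
  have hε0 : Tendsto ε atTop (𝓝 0) := by
    have h := (tendsto_pow_atTop_nhds_zero_of_lt_one (r := (1 / 2 : ℝ)) (by norm_num)
      (by norm_num)).const_mul (‖x‖ + 1)
    rw [mul_zero] at h
    refine h.congr fun n => ?_
    simp only [ε]
    rw [one_div, inv_pow, ← div_eq_mul_inv]
  have h1 : Tendsto (fun n => ‖x - (w n).1‖) atTop (𝓝 ‖x - x₀‖) :=
    (hx₀.const_sub x).norm
  have h2 := hε0.const_add d
  rw [add_zero] at h2
  exact le_of_tendsto_of_tendsto' h1 h2 fun n => (w n).2.2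

end BigO

theorem corollary1p2 {𝕜 X Y : Type*} [RCLike 𝕜]
    [NormedAddCommGroup X] [NormedSpace 𝕜 X] [CompleteSpace X]
    [NormedAddCommGroup Y] [NormedSpace 𝕜 Y] [CompleteSpace Y]
    -- `X` is separable and reflexive
    [TopologicalSpace.SeparableSpace X]
    (hrefl : Function.Surjective (NormedSpace.inclusionInDoubleDual 𝕜 X))
    -- the family `𝓛`, with its topology `τ`
    (𝓛 : Set (X →L[𝕜] Y)) [TopologicalSpace (OpFamily 𝓛)]
    [T2Space (OpFamily 𝓛)] [SigmaCompactSpace (OpFamily 𝓛)] [LocallyCompactSpace (OpFamily 𝓛)]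
    (hcont : ∀ x : X, Continuous fun L : OpFamily 𝓛 => L.op x)
    -- `M(X, 𝓛)` is dense in `X`, and is a Banach space continuously contained in `X`
    (hdense : DenseRange (BigO.incl 𝓛))
    [CompleteSpace (BigO 𝓛)]
    (hincl : ∃ C : ℝ, ∀ x : BigO 𝓛, ‖BigO.incl 𝓛 x‖ ≤ C * ‖x‖)
    -- the approximation property
    (happrox : ∀ x : BigO 𝓛, ∃ u : ℕ → BigO 𝓛, (∀ n, u n ∈ LittleO 𝓛) ∧
      (∀ φ : StrongDual 𝕜 X,
        Tendsto (fun n => φ (BigO.incl 𝓛 (u n))) atTop (𝓝 (φ (BigO.incl 𝓛 x)))) ∧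
      ∀ n, ‖u n‖ ≤ ‖x‖)
    (x : BigO 𝓛) :
    (∃ x₀ ∈ LittleO 𝓛, ‖x - x₀‖ = Metric.infDist x (LittleO 𝓛 : Set (BigO 𝓛))) ∧
      Metric.infDist x (LittleO 𝓛 : Set (BigO 𝓛)) = limsupAtInfty 𝓛 x := by
  have happ : ∀ y : BigO 𝓛, ∀ K : Set (OpFamily 𝓛), IsCompact K → ∀ η > 0,
      ∃ v ∈ LittleO 𝓛, ‖v‖ ≤ ‖y‖ ∧ ∀ L ∈ K, ‖L.op (BigO.incl 𝓛 (y - v))‖ ≤ η := by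
    intro y K hK η hη
    obtain ⟨u, hu, hlim, hle⟩ := happrox y
    obtain ⟨C, hC, hCK⟩ := BigO.exists_norm_op_le_of_isCompact hcont hK
    obtain ⟨v, hv, hvn, hyv⟩ :=
      -- Closeness `η / C` in `X` becomes `η` after applying any `L` in `K`, where `‖L‖ ≤ C`.
      BigO.exists_littleO_norm_incl_sub_lt hu hlim hle (div_pos hη hC)
    refine ⟨v, hv, hvn, fun L hL => ?_⟩
    calc ‖L.op (BigO.incl 𝓛 (y - v))‖ ≤ C * (η / C) :=
          L.op.le_of_opNorm_le_of_le (hCK L hL) hyv.le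
      _ = η := mul_div_cancel₀ _ hC.ne'
  obtain ⟨x₀, hx₀, hle⟩ := BigO.exists_littleO_norm_sub_le_limsupAtInfty happ x
  have hge : limsupAtInfty 𝓛 x ≤ Metric.infDist x (LittleO 𝓛 : Set (BigO 𝓛)) :=
    (Metric.le_infDist ⟨x₀, hx₀⟩).2 fun {w} hw => by
      rw [dist_eq_norm]
      exact BigO.limsupAtInfty_le_norm_sub x hw
  have hinf : Metric.infDist x (LittleO 𝓛 : Set (BigO 𝓛)) ≤ ‖x - x₀‖ := by
    rw [← dist_eq_norm]
    exact Metric.infDist_le_dist_of_mem hx₀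
  exact ⟨⟨x₀, hx₀, le_antisymm (hle.trans hge) hinf⟩, le_antisymm (hinf.trans hle) hge⟩
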